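/- **Definitions.** Let $\mathrm{Pr}_n:\mathbb R^n\times\mathbb R^m\to\mathbb R^n$ be the orthogonal projection and $\lambda$ Lebesgue measure. A *continuous-time dynamical system* on a space $Y$ is a family $(\varphi_t)_{t\in\mathbb R}$ of homeomorphisms of $Y$ onto itself, jointly continuous in $(t,y)$, with $\varphi_0=\mathrm{id}$ (the group law is not required; flows are a special case). For $Y\subseteq\mathbb R^k$, a measurable map $T:Y\to Y$ *transfers* a density $f$ to a density $g$ on $Y$ if $T_*(f\lambda|_Y)=g\lambda|_Y$, i.e. $\int_{T^{-1}A}f\,d\lambda=\int_A g\,d\lambda$ for all measurable $A\subseteq Y$. It is *nonsingular* if $\lambda(A)=0$ implies $\lambda(T^{-1}A)=0$ for measurable $A\subseteq Y$; its *Frobenius–Perron operator* $P_T$ on integrable functions is then defined (a.e.) by $\int_A P_Tf\,d\lambda=\int_{T^{-1}A}f\,d\lambda$ for all measurable $A\subseteq Y$. The *support* of a density $g$ is the topological support of the measure $g\lambda$, i.e. the smallest closed set outside which $g=0$ almost everywhere. **Theorem.** Let $X\subset\mathbb R^n\times\mathbb R^m$ be a bounded domain (open and connected) and let $(\Phi_t)$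 be a continuous-time dynamical system on $X$. Let $F\subseteq X$ be compact and connected, and let $f$ be a probability density which is $C^1$ on $F$ and vanishes outside $F$. Suppose that $\Phi_1$ transfers $f$ to a probability density $g$ with support $G$, that $\mathrm{Pr}_n(G)\setminus\mathrm{Pr}_n(F)\neq\emptyset$, and that $\mathrm{Pr}_n(G)$ and $\mathrm{Pr}_n(F)$ are convex. Let $f^*(y)=\int_{\mathbb R^m}f(y,z)\,dz$ and $g^*(y)=\int_{\mathbb R^m}g(y,z)\,dz$ be the marginals on $\mathbb R^n$. Then: 1. For no continuous-time dynamical system $(\varphi_t)$ on $\mathrm{Pr}_n(G)$ and no $t\in\mathbb R$ does $\varphi_t$ transfer $f^*$ to $g^*$ (both restricted to $\mathrm{Pr}_n(G)$). 2. If $\mathrm{Pr}_n(F)\subseteq\mathrm{Pr}_n(G)$ (so that $f^*$ is a probability density on $\mathrm{Pr}_n(G)$), then there is a measurable nonsingular map $T:\mathrm{Pr}_n(G)\to\mathrm{Pr}_n(G)$ that is nonlinear (it does not coincide almost everywhere on $\mathrm{Pr}_n(G)$ with an affine map of $\mathbb R^n$) and transfers $f^*$ to $g^*$; that is, $P_Tf^*=g^*$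 almost everywhere. -/

import Mathlib

open MeasureTheory Set

-- Subsets of `ℝⁿ` and `ℝⁿ × ℝᵐ` carry the restriction of Lebesgue measure.
attribute [local instance] Measure.Subtype.measureSpace

/-- The space `ℝⁿ × ℝᵐ` of visible and invisible variables. Its orthogonal projection onto `ℝⁿ`
is `Prod.fst`, and its volume is Lebesgue measure. -/
abbrev FullSpace (n m : ℕ) : Type :=
  EuclideanSpace ℝ (Fin n) × EuclideanSpace ℝ (Fin m)

/-- A probability density function with respect to the reference measure. -/
structure IsProbDensity {α : Type*} [MeasureSpace α] (f : α → ℝ) : Prop where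
  nonneg : ∀ᵐ x, 0 ≤ f x
  integrable : Integrable f
  integral_eq_one : ∫ x, f x = 1

/-- The (possibly infinite) measure with density `f` with respect to the reference measure. -/
noncomputable def densityMeasure {α : Type*} [MeasureSpace α] (f : α → ℝ) : Measure α :=
  (volume : Measure α).withDensity fun x => ENNReal.ofReal (f x)

/-- The support of a density: the topological support of the measure it defines, that is, the
complement of the largest open set on which the density vanishes almost everywhere. -/
noncomputable def densitySupport {α : Type*} [TopologicalSpace α] [MeasureSpace α] (f : α → ℝ) :
    Set α :=
  (densityMeasure f).support

/-- The map `T` transfers the density `f` to the density `g`: the image under `T` of the measure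
with density `f` is the measure with density `g`. -/
def Transfers {α : Type*} [MeasureSpace α] (T : α → α) (f g : α → ℝ) : Prop :=
  Measurable T ∧ (densityMeasure f).map T = densityMeasure g

/-- A continuous-time dynamical system on `α`: a family of homeomorphisms `φ_t` of `α` onto itself,
starting at the identity and jointly continuous in time and space. The group law
`φ_(s + t) = φ_s ∘ φ_t` is not imposed, so that time-dependent evolutions are covered along with
flows. -/
structure ContinuousTimeSystem (α : Type*) [TopologicalSpace α] where
  toHomeo : ℝ → α ≃ₜ α
  map_zero : ∀ x, toHomeo 0 x = x
  continuous_uncurry : Continuous fun p : ℝ × α => toHomeo p.1 p.2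

/-- A flow, i.e. a continuous action of the time line `ℝ`, is a continuous-time system. -/
def Flow.toContinuousTimeSystem {α : Type*} [TopologicalSpace α] (φ : Flow ℝ α) :
    ContinuousTimeSystem α where
  toHomeo := φ.toHomeomorph
  map_zero x := φ.map_zero_apply x
  continuous_uncurry := φ.cont'

/-- The marginal on `ℝⁿ` of a density on `ℝⁿ × ℝᵐ`. -/
noncomputable def marginal {n m : ℕ} (f : FullSpace n m → ℝ) (y : EuclideanSpace ℝ (Fin n)) : ℝ :=
  ∫ z : EuclideanSpace ℝ (Fin m), f (y, z)

/-- The Frobenius–Perron operator of `T`: the density with respect to the reference measure of the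
image under `T` of the signed measure with density `f`. -/
noncomputable def frobeniusPerron {α : Type*} [MeasureSpace α] (T : α → α) (f : α → ℝ) : α → ℝ :=
  SignedMeasure.rnDeriv (((volume : Measure α).withDensityᵥ f).map T) volume

/-- The identity characterizing the Frobenius–Perron operator of a nonsingular map. -/
theorem setIntegral_frobeniusPerron {α : Type*} [MeasureSpace α]
    [SigmaFinite (volume : Measure α)] {T : α → α}
    (hT : Measure.QuasiMeasurePreserving T volume volume) {f : α → ℝ} (hf : Integrable f)
    {A : Set α} (hA : MeasurableSet A) :
    ∫ x in A, frobeniusPerron T f x = ∫ x in T ⁻¹' A, f x := by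
  have hac : VectorMeasure.AbsolutelyContinuous
      (((volume : Measure α).withDensityᵥ f).map T)
      (volume : Measure α).toENNRealVectorMeasure := by
    refine VectorMeasure.AbsolutelyContinuous.mk fun s hs h0 => ?_
    rw [Measure.toENNRealVectorMeasure_apply_measurable hs] at h0
    rw [VectorMeasure.map_apply _ hT.measurable hs, withDensityᵥ_apply hf (hT.measurable hs)]
    exact setIntegral_measure_zero _ (hT.preimage_null h0)
  have h := SignedMeasure.withDensityᵥ_rnDeriv_eq _ _ hac
  have h' := congrArg (fun v : SignedMeasure α => v A) h
  rw [withDensityᵥ_apply (SignedMeasure.integrable_rnDeriv _ _) hA,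
    VectorMeasure.map_apply _ hT.measurable hA, withDensityᵥ_apply hf (hT.measurable hA)] at h'
  exact h'

/-- A discrete-time system on a subset `K` of `ℝⁿ`, given by the map `T : K → K`, is nonsingular
(measurable, and preimages of null sets are null, so that its Frobenius–Perron operator is defined)
and nonlinear (it does not agree almost everywhere on `K` with an affine map). -/
structure IsNonlinearDiscreteSystem {n : ℕ} {K : Set (EuclideanSpace ℝ (Fin n))} (T : K → K) :
    Prop where
  nonsingular : Measure.QuasiMeasurePreserving T volume volume
  nonlinear : ∀ A : EuclideanSpace ℝ (Fin n) →ᵃ[ℝ] EuclideanSpace ℝ (Fin n),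
    ¬ ∀ᵐ x : K, (T x : EuclideanSpace ℝ (Fin n)) = A x

/-! Both claims rest on one contrast. On the part of `Pr_n(G)` outside the closed set `Pr_n(F)`, a
nonempty relatively open set, `f*` vanishes, while `g*` charges every nonempty relatively open
subset of `Pr_n(G)`.

A homeomorphism maps this open set to a nonempty open set, which would receive zero mass from `f*`
but has positive mass under `g*`; hence claim 1.

For claim 2 only measurability is required. Since `f*` is atomless, its distribution can be carried
to the uniform law on `[0,1]` by a distribution function, and from there to that of `g*`. Using this
transport only where `f*` is positive and the identity elsewhere makes the map nonsingular
(`exists_transport_of_absolutelyContinuous`). An affine map agreeing with it almost everywhere would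
be the identity on an open set, hence everywhere, forcing the two distributions to coincide. -/

section Transport

open ProbabilityTheory Filter
open scoped unitInterval Topology

/-- The cumulative distribution function of an atomless probability measure is continuous. -/
theorem continuous_cdf (ρ : Measure ℝ) [IsProbabilityMeasure ρ] [NullSingletonClass ρ] :
    Continuous (cdf ρ) := by
  refine continuous_iff_continuousAt.2 fun x => ?_
  rw [(monotone_cdf ρ).continuousAt_iff_leftLim_eq_rightLim, (cdf ρ).rightLim_eq]
  -- The mass of `{x}` is the jump of the distribution function at `x`.
  have h := (cdf ρ).measure_singleton x
  rw [measure_cdf, measure_singleton, eq_comm, ENNReal.ofReal_eq_zero, sub_nonpos] at h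
  exact le_antisymm ((monotone_cdf ρ).leftLim_le le_rfl) h

/-- Intermediate value theorem between the limits 0 and 1. The bounds on `u` are strict because
these limits need not be attained. -/
theorem exists_cdf_eq (ρ : Measure ℝ) [IsProbabilityMeasure ρ] [NullSingletonClass ρ] {u : ℝ}
    (h0 : 0 < u) (h1 : u < 1) : ∃ x, cdf ρ x = u :=
  mem_range_of_exists_le_of_exists_ge (continuous_cdf ρ)
    (((tendsto_cdf_atBot ρ).eventually (gt_mem_nhds h0)).exists.imp fun _ => le_of_lt)
    (((tendsto_cdf_atTop ρ).eventually (lt_mem_nhds h1)).exists.imp fun _ => le_of_lt)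

/-- The cumulative distribution function of an atomless probability measure transports it to the
uniform distribution. -/
theorem measure_cdf_le (ρ : Measure ℝ) [IsProbabilityMeasure ρ] [NullSingletonClass ρ] (u : I) :
    ρ {x | cdf ρ x ≤ u} = ENNReal.ofReal u := by
  apply le_antisymm
  · rcases u.2.2.eq_or_lt with h1 | h1
    · rw [h1, ENNReal.ofReal_one]
      exact prob_le_one
    -- Bound by every attained value `v = cdf ρ x` slightly above `u`, then let `v` decrease to `u`;
    -- this covers `u = 0`, which may not be attained.
    · refine ge_of_tendsto (ENNReal.continuous_ofReal.continuousWithinAt (s := Ioi (u : ℝ))) ?_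
      filter_upwards [Ioo_mem_nhdsGT h1] with v hv
      obtain ⟨x, hx⟩ := exists_cdf_eq ρ (u.2.1.trans_lt hv.1) hv.2
      rw [← hx, ofReal_cdf]
      refine measure_mono fun y hy => ?_
      by_contra hxy
      exact absurd (hv.1.trans_le (hx.symm.le.trans (monotone_cdf ρ (not_le.1 hxy).le)))
        (not_lt.2 hy)
  · rcases u.2.1.eq_or_lt with h0 | h0
    · rw [← h0, ENNReal.ofReal_zero]
      exact zero_le
    rcases u.2.2.eq_or_lt with h1 | h1
    · have : {x | cdf ρ x ≤ u} = univ := eq_univ_of_forall fun x => by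
        simpa [h1] using cdf_le_one ρ x
      rw [this, measure_univ, h1, ENNReal.ofReal_one]
    · obtain ⟨x, hx⟩ := exists_cdf_eq ρ h0 h1
      rw [← hx, ofReal_cdf]
      exact measure_mono fun y hy => monotone_cdf ρ hy

/-- An atomless probability measure on a standard Borel space can be transported to any probability
measure on a standard Borel space. -/
theorem exists_measurable_map_eq_of_nullSingletonClass {α β : Type*} [MeasurableSpace α]
    [StandardBorelSpace α] [MeasurableSpace β] [StandardBorelSpace β] [Nonempty β]
    (μ : Measure α) [IsProbabilityMeasure μ] [NullSingletonClass μ]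
    (ν : Measure β) [IsProbabilityMeasure ν] :
    ∃ S : α → β, Measurable S ∧ μ.map S = ν := by
  -- `q` carries the uniform measure on the unit interval to `ν`; it remains to carry `μ` to the
  -- uniform measure.
  obtain ⟨q, hq, hqν⟩ := ν.exists_measurable_map_eq
  have he := measurableEmbedding_embeddingReal α
  set ρ := μ.map (embeddingReal α) with hρ
  have : IsProbabilityMeasure ρ := Measure.isProbabilityMeasure_map he.measurable.aemeasurable
  have : NullSingletonClass ρ := ⟨fun x => by
    rw [hρ, he.map_apply]
    exact (subsingleton_singleton.preimage he.injective).measure_zero μ⟩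
  let c : ℝ → I := fun x => ⟨cdf ρ x, cdf_nonneg ρ x, cdf_le_one ρ x⟩
  have hc : Measurable c := (monotone_cdf ρ).measurable.subtype_mk
  have hcρ : ρ.map c = volume := by
    have : IsProbabilityMeasure (ρ.map c) := Measure.isProbabilityMeasure_map hc.aemeasurable
    refine Measure.ext_of_Iic _ _ fun u => ?_
    rw [Measure.map_apply hc measurableSet_Iic, unitInterval.volume_Iic]
    exact measure_cdf_le ρ u
  refine ⟨q ∘ c ∘ embeddingReal α, hq.comp (hc.comp he.measurable), ?_⟩
  rw [← Measure.map_map hq (hc.comp he.measurable), ← Measure.map_map hc he.measurable, ← hρ, hcρ,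
    hqν]

end Transport

/-! ### Nonsingular transport and measures given by densities. -/

section Density

/-- Between two absolutely continuous probability measures there is a nonsingular transport map which
is almost everywhere the identity on the null sets of the first one. -/
theorem exists_transport_of_absolutelyContinuous {α : Type*} [MeasurableSpace α]
    [StandardBorelSpace α] (l μ ν : Measure α) [SigmaFinite l] [IsProbabilityMeasure μ]
    [NullSingletonClass μ] [IsProbabilityMeasure ν] (hμ : μ ≪ l) (hν : ν ≪ l) :
    ∃ T : α → α, Measure.QuasiMeasurePreserving T l l ∧ μ.map T = ν ∧
      ∀ U, μ U = 0 → ∀ᵐ x ∂l, x ∈ U → T x = x := by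
  have : Nonempty α := ν.nonempty_of_neZero
  obtain ⟨S, hS, hSν⟩ := exists_measurable_map_eq_of_nullSingletonClass μ ν
  set r := μ.rnDeriv l
  have hr : Measurable r := Measure.measurable_rnDeriv μ l
  have hμr : l.withDensity r = μ := Measure.withDensity_rnDeriv_eq μ l hμ
  have hP : MeasurableSet {x | r x ≠ 0} := (measurableSet_singleton 0).compl.preimage hr
  have hnull : ∀ s, μ s = 0 → l ({x | r x ≠ 0} ∩ s) = 0 := fun s hs => by
    rw [← hμr] at hs
    exact (withDensity_apply_eq_zero hr).1 hs
  have hPc : ∀ᵐ x ∂μ, r x ≠ 0 := by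
    rw [ae_iff, ← hμr, withDensity_apply_eq_zero hr]
    convert! measure_empty (μ := l)
    ext x
    simp
  classical
  have hT : Measurable ({x | r x ≠ 0}.piecewise S id) := hS.piecewise hP measurable_id
  have hTν : μ.map ({x | r x ≠ 0}.piecewise S id) = ν := by
    rw [← hSν]
    exact Measure.map_congr (hPc.mono fun x hx => piecewise_eq_of_mem _ _ _ hx)
  refine ⟨{x | r x ≠ 0}.piecewise S id, ⟨hT, ?_⟩, hTν, fun U h0 => ?_⟩
  -- The preimage of a null set `A` splits in two. Where `r ≠ 0` it is `μ`-null, because `ν A = 0`,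
  -- hence `l`-null; where `r = 0` the map is the identity, so that part lies in `A`.
  · refine Measure.AbsolutelyContinuous.mk fun A hA h0 => ?_
    rw [Measure.map_apply hT hA]
    have h1 : μ ({x | r x ≠ 0}.piecewise S id ⁻¹' A) = 0 := by
      rw [← Measure.map_apply hT hA, hTν]
      exact hν h0
    refine measure_mono_null (fun x hx => ?_) (measure_union_null (hnull _ h1) h0)
    by_cases h : r x ≠ 0
    · exact Or.inl ⟨h, hx⟩
    · refine Or.inr ?_
      rwa [mem_preimage, piecewise_eq_of_notMem _ _ _ h] at hx
  · have h := hnull U h0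
    rw [measure_eq_zero_iff_ae_notMem] at h
    filter_upwards [h] with x hx hxU
    exact piecewise_eq_of_notMem _ _ _ fun h => hx ⟨h, hxU⟩

variable {α : Type*} [MeasureSpace α]

theorem densityMeasure_absolutelyContinuous (f : α → ℝ) : densityMeasure f ≪ volume :=
  withDensity_absolutelyContinuous _ _

theorem isProbabilityMeasure_densityMeasure {f : α → ℝ} (hf : IsProbDensity f) :
    IsProbabilityMeasure (densityMeasure f) := by
  constructor
  rw [densityMeasure, withDensity_apply _ MeasurableSet.univ, Measure.restrict_univ,
    ← ofReal_integral_eq_lintegral_ofReal hf.integrable hf.nonneg, hf.integral_eq_one,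
    ENNReal.ofReal_one]

theorem densityMeasure_apply_eq_zero {f : α → ℝ} {s : Set α} (hs : MeasurableSet s)
    (h : ∀ x ∈ s, f x = 0) : densityMeasure f s = 0 := by
  rw [densityMeasure, withDensity_apply _ hs, setLIntegral_eq_zero hs]
  intro x hx
  simp [h x hx]

theorem map_val_densityMeasure {s : Set α} (hs : MeasurableSet s) (f : α → ℝ) :
    (densityMeasure (s.domRestrict f)).map Subtype.val = (densityMeasure f).restrict s := by
  ext A hA
  rw [Measure.map_apply measurable_subtype_coe hA, Measure.restrict_apply hA, densityMeasure,
    densityMeasure, withDensity_apply _ (measurable_subtype_coe hA),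
    withDensity_apply _ (hA.inter hs), ← Measure.restrict_restrict hA]
  exact (measurePreserving_subtype_coe hs).setLIntegral_comp_preimage_emb
    (MeasurableEmbedding.subtype_coe hs) (fun x => ENNReal.ofReal (f x)) A

theorem IsProbDensity.domRestrict {f : α → ℝ} (hf : IsProbDensity f) {s : Set α}
    (hs : MeasurableSet s) (h : densityMeasure f sᶜ = 0) : IsProbDensity (s.domRestrict f) := by
  have he := MeasurableEmbedding.subtype_coe hs
  have hp := measurePreserving_subtype_coe (μa := (volume : Measure α)) hs
  have h0 : ∀ᵐ x ∂volume.restrict s, 0 ≤ f x := ae_restrict_of_ae hf.nonneg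
  have hfc : ∫ x in sᶜ, f x = 0 := by
    rw [integral_eq_lintegral_of_nonneg_ae (ae_restrict_of_ae hf.nonneg)
      hf.integrable.aestronglyMeasurable.restrict, ← withDensity_apply _ hs.compl]
    simpa [densityMeasure] using congrArg ENNReal.toReal h
  refine ⟨hp.quasiMeasurePreserving.ae h0,
    (hp.integrable_comp_emb he).2 hf.integrable.integrableOn, ?_⟩
  refine (hp.integral_comp he f).trans ?_
  rw [← hf.integral_eq_one, ← integral_add_compl hs hf.integrable, hfc, add_zero]

/-- A map that transfers `f` to `g` has `g` as the image of `f` under its Frobenius–Perron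
operator. -/
theorem Transfers.frobeniusPerron_ae_eq [SigmaFinite (volume : Measure α)] {T : α → α}
    {f g : α → ℝ} (hT : Transfers T f g) (hf : IsProbDensity f) (hg : IsProbDensity g) :
    frobeniusPerron T f =ᵐ[volume] g := by
  -- Uniqueness of the Lebesgue decomposition, with singular part 0.
  refine (SignedMeasure.eq_rnDeriv 0 g hg.integrable
    (VectorMeasure.MutuallySingular.zero_left) ?_).symm
  rw [zero_add]
  ext A hA
  have h : ∀ {k : α → ℝ}, IsProbDensity k → ∀ B, MeasurableSet B →
      ∫ x in B, k x = (densityMeasure k B).toReal := fun hk B hB => by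
    rw [densityMeasure, withDensity_apply _ hB, integral_eq_lintegral_of_nonneg_ae
      (ae_restrict_of_ae hk.nonneg) hk.integrable.aestronglyMeasurable.restrict]
  rw [VectorMeasure.map_apply _ hT.1 hA, withDensityᵥ_apply hf.integrable (hT.1 hA),
    withDensityᵥ_apply hg.integrable hA, h hf _ (hT.1 hA), h hg _ hA, ← hT.2,
    Measure.map_apply hT.1 hA]

end Density

/-! ### Marginals as projected measures. -/

section Marginal

variable {n m : ℕ}

theorem map_fst_densityMeasure {f : FullSpace n m → ℝ} (hf : IsProbDensity f) :
    (densityMeasure f).map Prod.fst = densityMeasure (marginal f) := by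
  ext A hA
  have hfi : Integrable f (volume.prod volume) := hf.integrable
  have hnn : ∀ᵐ y : EuclideanSpace ℝ (Fin n), ∀ᵐ z : EuclideanSpace ℝ (Fin m), 0 ≤ f (y, z) :=
    Measure.ae_ae_of_ae_prod hf.nonneg
  have hset : Prod.fst ⁻¹' A = A ×ˢ (univ : Set (EuclideanSpace ℝ (Fin m))) := by ext; simp
  rw [Measure.map_apply measurable_fst hA, densityMeasure, densityMeasure,
    withDensity_apply _ (measurable_fst hA), withDensity_apply _ hA, hset, Measure.volume_eq_prod,
    ← Measure.prod_restrict, Measure.restrict_univ, lintegral_prod]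
  · refine lintegral_congr_ae (ae_restrict_of_ae ?_)
    filter_upwards [hnn, hfi.prod_right_ae] with y h0 hi
    exact (ofReal_integral_eq_lintegral_ofReal hi h0).symm
  · have : (volume.restrict A).prod volume ≪
        (volume : Measure (EuclideanSpace ℝ (Fin n))).prod
          (volume : Measure (EuclideanSpace ℝ (Fin m))) :=
      Measure.restrict_le_self.absolutelyContinuous.prod Measure.AbsolutelyContinuous.rfl
    exact hfi.aestronglyMeasurable.aemeasurable.ennreal_ofReal.mono_ac this

theorem IsProbDensity.marginal {f : FullSpace n m → ℝ} (hf : IsProbDensity f) :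
    IsProbDensity (marginal f) := by
  have hfi : Integrable f (volume.prod volume) := hf.integrable
  refine ⟨?_, hfi.integral_prod_left, ?_⟩
  · filter_upwards [Measure.ae_ae_of_ae_prod (μ := volume) (ν := volume) hf.nonneg] with y hy
    exact integral_nonneg_of_ae hy
  · rw [← hf.integral_eq_one, Measure.volume_eq_prod, integral_prod f hfi]
    rfl

theorem marginal_eq_zero {F : Set (FullSpace n m)} {f : FullSpace n m → ℝ}
    (hfF : ∀ x, x ∉ F → f x = 0) {y : EuclideanSpace ℝ (Fin n)} (hy : y ∉ Prod.fst '' F) :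
    _root_.marginal f y = 0 := by
  have : ∀ z, f (y, z) = 0 := fun z => hfF _ fun h => hy ⟨_, h, rfl⟩
  simp [_root_.marginal, this]

end Marginal

theorem densityMeasure_compl_densitySupport {n m : ℕ} (g : FullSpace n m → ℝ) :
    densityMeasure g (densitySupport g)ᶜ = 0 :=
  Measure.measure_compl_support

/-- The support of a density transferred from one that vanishes outside a compact set is compact. -/
theorem isCompact_densitySupport_of_transfers {n m : ℕ} {X F : Set (FullSpace n m)}
    (hX : MeasurableSet X) {h : X → X} (hh : Continuous h) (hFX : F ⊆ X) (hF : IsCompact F)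
    {f g : FullSpace n m → ℝ} (hf : IsProbDensity f) (hfF : ∀ x, x ∉ F → f x = 0)
    (hg : IsProbDensity g) (hfg : Transfers h (X.domRestrict f) (X.domRestrict g)) :
    IsCompact (densitySupport g) := by
  have := isProbabilityMeasure_densityMeasure hf
  have := isProbabilityMeasure_densityMeasure hg
  have hF' : IsCompact (Subtype.val ⁻¹' F : Set X) :=
    Subtype.isCompact_iff.2 (by rwa [Subtype.image_preimage_coe, inter_eq_right.2 hFX])
  have hC : IsCompact (Subtype.val '' (h '' (Subtype.val ⁻¹' F : Set X))) :=
    (hF'.image hh).image continuous_subtype_val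
  set C := Subtype.val '' (h '' (Subtype.val ⁻¹' F : Set X))
  have hF1 : densityMeasure f F = 1 := (prob_compl_eq_zero_iff hF.measurableSet).1
    (densityMeasure_apply_eq_zero hF.measurableSet.compl hfF)
  -- The compact image `C` of `F` carries all the mass of `g`, so it contains the support.
  have hC1 : densityMeasure g C = 1 := by
    refine le_antisymm prob_le_one ?_
    calc 1 = (densityMeasure f).restrict X F := by
          rw [Measure.restrict_apply hF.measurableSet, inter_eq_left.2 hFX, hF1]
      _ = densityMeasure (X.domRestrict f) (Subtype.val ⁻¹' F) := by
          rw [← map_val_densityMeasure hX, Measure.map_apply measurable_subtype_coe hF.measurableSet]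
      _ ≤ densityMeasure (X.domRestrict f) (h ⁻¹' (Subtype.val ⁻¹' C)) :=
          measure_mono fun x hx => ⟨h x, ⟨x, hx, rfl⟩, rfl⟩
      _ = densityMeasure (X.domRestrict g) (Subtype.val ⁻¹' C) := by
          rw [← hfg.2, Measure.map_apply hfg.1 (measurable_subtype_coe hC.measurableSet)]
      _ = (densityMeasure g).restrict X C := by
          rw [← map_val_densityMeasure hX, Measure.map_apply measurable_subtype_coe hC.measurableSet]
      _ ≤ densityMeasure g C := Measure.restrict_apply_le _ _
  refine hC.of_isClosed_subset Measure.isClosed_support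
    (Measure.support_subset_of_isClosed hC.isClosed ?_)
  exact (prob_compl_eq_zero_iff hC.measurableSet).2 hC1

/-- The marginal of a density with compact support is concentrated on the projection of the
support. -/
theorem densityMeasure_marginal_compl {n m : ℕ} {g : FullSpace n m → ℝ} (hg : IsProbDensity g)
    (hG : IsCompact (densitySupport g)) :
    densityMeasure (marginal g) (Prod.fst '' densitySupport g)ᶜ = 0 := by
  have hK := (hG.image continuous_fst).measurableSet
  rw [← map_fst_densityMeasure hg, Measure.map_apply measurable_fst hK.compl]
  exact measure_mono_null (fun x hx hxG => hx ⟨x, hxG, rfl⟩)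
    (densityMeasure_compl_densitySupport g)

/-- The marginal of a density with compact support charges every nonempty relatively open subset of
the projection of the support. -/
theorem densityMeasure_marginal_ne_zero {n m : ℕ} {g : FullSpace n m → ℝ} (hg : IsProbDensity g)
    (hG : IsCompact (densitySupport g)) {V : Set ↥(Prod.fst '' densitySupport g)}
    (hV : IsOpen V) (hne : V.Nonempty) :
    densityMeasure ((Prod.fst '' densitySupport g).domRestrict (marginal g)) V ≠ 0 := by
  have hK := (hG.image continuous_fst).measurableSet
  obtain ⟨W, hW, rfl⟩ := isOpen_induced_iff.1 hV
  rw [← Measure.map_apply measurable_subtype_coe hW.measurableSet, map_val_densityMeasure hK,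
    Measure.restrict_eq_self_of_ae_mem
      (s := Prod.fst '' densitySupport g) (densityMeasure_marginal_compl hg hG),
    ← map_fst_densityMeasure hg, Measure.map_apply measurable_fst hW.measurableSet]
  -- The cylinder over `W` is a neighbourhood of a support point `x`, so it has positive mass.
  obtain ⟨⟨_, x, hx, rfl⟩, hxW⟩ := hne
  exact ((Measure.mem_support_iff_forall x).1 hx _
    ((hW.preimage continuous_fst).mem_nhds hxW)).ne'

/-- A homeomorphism cannot transfer a density that vanishes on a nonempty open set to one that
charges every nonempty open set. -/
theorem not_transfers_homeomorph {α : Type*} [TopologicalSpace α] [MeasureSpace α] [BorelSpace α]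
    {f g : α → ℝ} {U : Set α} (hU : IsOpen U) (hne : U.Nonempty) (hf : ∀ x ∈ U, f x = 0)
    (hg : ∀ V, IsOpen V → V.Nonempty → densityMeasure g V ≠ 0) (φ : α ≃ₜ α) :
    ¬ Transfers φ f g := fun h => by
  refine hg (φ '' U) (φ.isOpenMap U hU) (hne.image φ) ?_
  rw [← h.2, Measure.map_apply h.1 (φ.isOpenMap U hU).measurableSet,
    preimage_image_eq _ φ.injective]
  exact densityMeasure_apply_eq_zero hU.measurableSet hf

/-- On a closed convex set of positive volume, every nonempty relatively open subset contains a
nonempty open subset of the ambient space. -/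
theorem exists_isOpen_subset_of_convex {E : Type*} [NormedAddCommGroup E] [NormedSpace ℝ E]
    [FiniteDimensional ℝ E] [MeasurableSpace E] [BorelSpace E] (l : Measure E)
    [l.IsAddHaarMeasure] {K V : Set E} (hK : Convex ℝ K) (hKl : l K ≠ 0) (hV : IsOpen V)
    (hne : (K ∩ V).Nonempty) : (interior K ∩ V).Nonempty := by
  have hint : (interior K).Nonempty := by
    rw [nonempty_iff_ne_empty]
    intro h
    -- With empty interior, `K` would lie in its own frontier, which is null by convexity.
    refine hKl (measure_mono_null (fun x hx => ?_) (hK.addHaar_frontier l))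
    exact ⟨subset_closure hx, by simp [h]⟩
  obtain ⟨x, hxK, hxV⟩ := hne
  have hx : x ∈ closure (interior K) := by
    rw [hK.closure_interior_eq_closure_of_nonempty_interior hint]
    exact subset_closure hxK
  rw [inter_comm]
  exact mem_closure_iff.1 hx V hV hxV

/-- An affine map that is almost everywhere the identity on a nonempty open set is the identity. -/
theorem affineMap_eq_id_of_ae {E : Type*} [NormedAddCommGroup E] [NormedSpace ℝ E]
    [FiniteDimensional ℝ E] [MeasurableSpace E] [BorelSpace E] (l : Measure E) [l.IsOpenPosMeasure]
    {W : Set E} (hW : IsOpen W) (hne : W.Nonempty) (A : E →ᵃ[ℝ] E)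
    (h : ∀ᵐ x ∂l, x ∈ W → A x = x) (x : E) : A x = x := by
  have hWeq : EqOn A id W := by
    refine Measure.eqOn_open_of_ae_eq (μ := l) ?_ hW
      A.continuous_of_finiteDimensional.continuousOn continuousOn_id
    exact (ae_restrict_iff' hW.measurableSet).2 h
  have : A = AffineMap.id ℝ E := AffineMap.ext_on (hW.affineSpan_eq_top hne) hWeq
  rw [this, AffineMap.id_apply]

/-- Nonlinearity comes from `V`: the transport is the identity almost everywhere on `K ∩ V`, where
`f` vanishes. Convexity puts an open set of the ambient space inside `K ∩ V`, enough to determine an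
affine map. The condition `n ≠ 0` makes Lebesgue measure atomless. -/
theorem exists_nonlinear_transfer {n : ℕ} (hn : n ≠ 0) {K V : Set (EuclideanSpace ℝ (Fin n))}
    (hK : MeasurableSet K) (hKconv : Convex ℝ K) (hV : IsOpen V) (hne : (K ∩ V).Nonempty)
    {f g : K → ℝ} (hf : IsProbDensity f) (hg : IsProbDensity g)
    (hfV : ∀ x : K, (x : EuclideanSpace ℝ (Fin n)) ∈ V → f x = 0)
    (hgpos : ∀ U : Set K, IsOpen U → U.Nonempty → densityMeasure g U ≠ 0) :
    ∃ T : K → K, IsNonlinearDiscreteSystem T ∧ Transfers T f g ∧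
      frobeniusPerron T f =ᵐ[volume] g := by
  have : NeZero n := ⟨hn⟩
  have : StandardBorelSpace K := hK.standardBorel
  have := isProbabilityMeasure_densityMeasure hf
  have := isProbabilityMeasure_densityMeasure hg
  have hfac := densityMeasure_absolutelyContinuous f
  have hgac := densityMeasure_absolutelyContinuous g
  have he := MeasurableEmbedding.subtype_coe hK
  have hp := measurePreserving_subtype_coe (μa := (volume : Measure (EuclideanSpace ℝ (Fin n)))) hK
  have : SigmaFinite (volume : Measure K) :=
    SigmaFinite.of_map _ measurable_subtype_coe.aemeasurable
      (hp.map_eq.symm ▸ inferInstance : SigmaFinite (Measure.map Subtype.val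
        (Measure.comap Subtype.val (volume : Measure (EuclideanSpace ℝ (Fin n))))))
  have : NullSingletonClass (densityMeasure f) := ⟨fun x => hfac (by
    rw [← volume_image_subtype_coe hK, image_singleton, measure_singleton])⟩
  have hVK : IsOpen (Subtype.val ⁻¹' V : Set K) := hV.preimage continuous_subtype_val
  obtain ⟨x₀, hx₀K, hx₀V⟩ := id hne
  have hneK : (Subtype.val ⁻¹' V : Set K).Nonempty := ⟨⟨x₀, hx₀K⟩, hx₀V⟩
  have hfV0 : densityMeasure f (Subtype.val ⁻¹' V) = 0 :=
    densityMeasure_apply_eq_zero hVK.measurableSet hfV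
  obtain ⟨T, hT, hTg, hTid⟩ := exists_transport_of_absolutelyContinuous _ _ _ hfac hgac
  have htr : Transfers T f g := ⟨hT.measurable, hTg⟩
  refine ⟨T, ⟨hT, fun A hA => ?_⟩, htr, htr.frobeniusPerron_ae_eq hf hg⟩
  have hKl : volume K ≠ 0 := fun h => by
    refine hgpos univ isOpen_univ ⟨⟨x₀, hx₀K⟩, trivial⟩ (hgac ?_)
    rw [Measure.Subtype.volume_univ hK.nullMeasurableSet, h]
  have hW := exists_isOpen_subset_of_convex volume hKconv hKl hV hne
  have hAid : ∀ᵐ x ∂(volume.restrict K), x ∈ V → A x = x := by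
    rw [← hp.map_eq, he.ae_map_iff]
    filter_upwards [hA, hTid _ hfV0] with x hx hx' hxV
    rw [← hx, hx' hxV]
  have hAW : ∀ᵐ x, x ∈ interior K ∩ V → A x = x := by
    filter_upwards [(ae_restrict_iff' hK).1 hAid] with x hx hxW
    exact hx (interior_subset hxW.1) hxW.2
  have hA1 := affineMap_eq_id_of_ae volume (isOpen_interior.inter hV) hW A hAW
  have hT1 : T =ᵐ[volume] id := by
    filter_upwards [hA] with x hx
    exact Subtype.ext (hx.trans (hA1 x))
  -- If `T` were the identity almost everywhere, `g` would give `K ∩ V` the same mass as `f`, namely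
  -- zero.
  refine hgpos _ hVK hneK ?_
  rw [← hTg, Measure.map_congr (hfac.ae_le hT1), Measure.map_id, hfV0]

theorem mainTheorem1 (n m : ℕ) (X F G : Set (FullSpace n m))
    (hXopen : IsOpen X) (hXconn : IsConnected X) (hXbdd : Bornology.IsBounded X)
    (Φ : ContinuousTimeSystem X)
    (hFX : F ⊆ X) (hFcomp : IsCompact F) (hFconn : IsConnected F)
    (f g : FullSpace n m → ℝ)
    (hf : IsProbDensity f) (hfC1 : ContDiffOn ℝ 1 f F) (hfF : ∀ x, x ∉ F → f x = 0)
    (hg : IsProbDensity g) (hgG : densitySupport g = G)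
    (hfg : Transfers (Φ.toHomeo 1) (X.domRestrict f) (X.domRestrict g))
    (hne : ((Prod.fst '' G) \ (Prod.fst '' F)).Nonempty)
    (hGconv : Convex ℝ (Prod.fst '' G)) (hFconv : Convex ℝ (Prod.fst '' F)) :
    (∀ (φ : ContinuousTimeSystem ↥(Prod.fst '' G)) (t : ℝ),
      ¬ Transfers (φ.toHomeo t)
        ((Prod.fst '' G).domRestrict (marginal f)) ((Prod.fst '' G).domRestrict (marginal g))) ∧
    (Prod.fst '' F ⊆ Prod.fst '' G →
      ∃ T : ↥(Prod.fst '' G) → ↥(Prod.fst '' G),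
        IsNonlinearDiscreteSystem T ∧
        Transfers T
          ((Prod.fst '' G).domRestrict (marginal f)) ((Prod.fst '' G).domRestrict (marginal g)) ∧
        frobeniusPerron T ((Prod.fst '' G).domRestrict (marginal f)) =ᵐ[volume]
          (Prod.fst '' G).domRestrict (marginal g)) := by
  subst hgG
  have hG := isCompact_densitySupport_of_transfers hXopen.measurableSet (Φ.toHomeo 1).continuous
    hFX hFcomp hf hfF hg hfg
  have hK := (hG.image continuous_fst).measurableSet
  have hPF : IsClosed (Prod.fst '' F) := (hFcomp.image continuous_fst).isClosed
  have hfV : ∀ x : ↥(Prod.fst '' densitySupport g), (x : EuclideanSpace ℝ (Fin n)) ∈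
      (Prod.fst '' F)ᶜ → (Prod.fst '' densitySupport g).domRestrict (marginal f) x = 0 :=
    fun x hx => marginal_eq_zero hfF hx
  have hgpos := fun V => densityMeasure_marginal_ne_zero hg hG (V := V)
  obtain ⟨x₀, hx₀G, hx₀F⟩ := id hne
  refine ⟨fun φ t => not_transfers_homeomorph (hPF.isOpen_compl.preimage continuous_subtype_val)
    ⟨⟨x₀, hx₀G⟩, hx₀F⟩ hfV hgpos (φ.toHomeo t), fun hsub => ?_⟩
  -- In dimension 0 the nonempty projection of `F` is the whole space, leaving no room for `x₀`.
  have hn : n ≠ 0 := by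
    rintro rfl
    obtain ⟨z, hz⟩ := hFconn.nonempty
    exact hx₀F ⟨z, hz, Subsingleton.elim _ _⟩
  refine exists_nonlinear_transfer hn hK hGconv hPF.isOpen_compl hne
    (hf.marginal.domRestrict hK ?_)
    (hg.marginal.domRestrict hK (densityMeasure_marginal_compl hg hG)) hfV hgpos
  -- The inclusion of projections ensures that restricting `f*` loses no mass.
  exact densityMeasure_apply_eq_zero hK.compl fun y hy =>
    marginal_eq_zero hfF fun h => hy (hsub h)
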